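/- Let $K\ge 0$ and $p_1,\dots,p_K\ge 0$ be integers and $p=\prod_k p_k$. For $\mathcal X\in\mathbb R^{p_1\times\cdots\times p_K}$, a HOSVD of $\mathcal X$ is $\mathcal X=U\cdot\mathcal S$, where $U=(U_1,\dots,U_K)$, each $U_k$ is a $p_k\times p_k$ orthogonal matrix of left singular vectors of the mode-$k$ matricization $\mathcal X_{(k)}$, with singular values $\sigma^k_1\ge\cdots\ge\sigma^k_{p_k}\ge 0$, the core is $\mathcal S=U^T\cdot\mathcal X$, and $\cdot$ is the multilinear (Tucker) product, $(A\cdot\mathcal X)_{\mathbf i}=\sum_{\mathbf j}\big(\prod_k (A_k)_{i_kj_k}\big)\mathcal X_{\mathbf j}$. For functions $g_{\mathbf i}:\mathbb R\to\mathbb R$ let $g(\mathcal S)_{\mathbf i}=g_{\mathbf i}(\mathcal S_{\mathbf i})$, and let $t(\mathcal X)=U\cdot g(\mathcal S)$. For $\tau\in\mathbb R$ let $$\mathrm{SURE}(t)(\mathcal X)=-p\tau^2+\|t(\mathcal X)-\mathcal X\|^2+2\tau^2\,\mathrm{div}(t)(\mathcal X),\qquad \mathrm{div}(t)=\sum_{\mathbf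 i}\frac{\partial t_{\mathbf i}}{\partial\mathcal X_{\mathbf i}}.$$ Fix $\mathcal X$ and a HOSVD $\mathcal X=U\cdot\mathcal S$ such that, for every $k$, the singular values $\sigma^k_1,\dots,\sigma^k_{p_k}$ are pairwise distinct. (a) There is a choice $\mathcal Y\mapsto U(\mathcal Y)$ of HOSVD factors for all arrays $\mathcal Y$ that is continuous at $\mathcal X$ and has $U(\mathcal X)=U$. (b) Let $\mathcal Y\mapsto U(\mathcal Y)$ be a choice of matrices such that $U(\mathcal Y)$ are HOSVD factors of $\mathcal Y$ for all $\mathcal Y$ near $\mathcal X$, and $U(\mathcal X)=U$. Let each $g_{\mathbf i}$ be differentiable at $\mathcal S_{\mathbf i}$ (e.g. soft-thresholding $g_{\mathbf i}(s)=\mathrm{sign}(s)(|s|-\lambda)_+$ with $\lambda\geq 0$, if $|\mathcal S_{\mathbf i}|\ne\lambda$ for all $\mathbf i$), and assume that $U(\cdot)$ is continuous at $\mathcal X$ or that all $g_{\mathbf i}$ are odd (in which case the signs of the singular vectors do not matter). Then $\mathcal X=U\cdot\mathcal S$, the estimator $t(\mathcal Y)=U(\mathcal Y)\cdot g(U(\mathcal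 Y)^T\cdot\mathcal Y)$ is differentiable at $\mathcal X$, $$\mathrm{div}(t)(\mathcal X)=\sum_{\mathbf i}\Big[\mathcal S_{\mathbf i}\,g_{\mathbf i}(\mathcal S_{\mathbf i})\sum_{k=1}^K\sum_{j\ne i_k}\frac{1}{(\sigma^k_{i_k})^2-(\sigma^k_j)^2}+g_{\mathbf i}'(\mathcal S_{\mathbf i})\Big(1+\sum_{k=1}^K\sum_{j\neq i_k}\frac{\mathcal S_{[i_1,\dots,i_{k-1},j,i_{k+1},\dots,i_K]}^2}{(\sigma^k_{i_k})^2-(\sigma^k_j)^2}\Big)\Big],$$ and, for every $\tau\in\mathbb R$, $$\mathrm{SURE}(t)(\mathcal X)=-p\tau^2+\|g(\mathcal S)-\mathcal S\|^2+2\tau^2\,\mathrm{div}(t)(\mathcal X)$$ with this value of the divergence. -/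

import Mathlib

open Filter Topology

noncomputable section

namespace HOSVD

/-- Multi-indices `(i_1, …, i_K)` of a `p_1 × ⋯ × p_K` array. -/
abbrev Idx {K : ℕ} (p : Fin K → ℕ) : Type := ∀ k : Fin K, Fin (p k)

/-- Real `p_1 × ⋯ × p_K` arrays, with the Frobenius (Euclidean) norm. -/
abbrev Tensor {K : ℕ} (p : Fin K → ℕ) : Type := EuclideanSpace ℝ (Idx p)

/-- Lists `(A_1, …, A_K)` of square matrices, `A_k` of size `p_k × p_k`. -/
abbrev Factors {K : ℕ} (p : Fin K → ℕ) : Type :=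
  ∀ k : Fin K, Matrix (Fin (p k)) (Fin (p k)) ℝ

variable {K : ℕ} {p : Fin K → ℕ}

/-- The multilinear (Tucker) product `(A_1, …, A_K) · X`. -/
def tucker (A : Factors p) (X : Tensor p) : Tensor p :=
  WithLp.toLp 2 fun i => ∑ j : Idx p, (∏ k, A k (i k) (j k)) * X j

/-- The mode-`k` matricization `X_(k)`: the row index is the `k`-th index of the array, the column
index runs over the remaining indices. -/
def unfold (k : Fin K) (X : Tensor p) :
    Matrix (Fin (p k)) (∀ l : {l : Fin K // l ≠ k}, Fin (p l)) ℝ :=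
  Matrix.of fun a r => X ((Equiv.piSplitAt k fun l => Fin (p l)).symm (a, r))

/-- `A = U diag(σ) Vᵀ` is a singular value decomposition with square orthogonal `U` and ordered
singular values. To allow matrices `A` of every shape, only the right singular vectors that belong
to nonzero singular values are required to be orthonormal. -/
structure IsSVD {m : ℕ} {n : Type} [Fintype n] (A : Matrix (Fin m) n ℝ)
    (U : Matrix (Fin m) (Fin m) ℝ) (σ : Fin m → ℝ) (V : Matrix n (Fin m) ℝ) : Prop where
  orthogonal : U ∈ Matrix.orthogonalGroup (Fin m) ℝ
  nonneg : ∀ j, 0 ≤ σ j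
  antitone : Antitone σ
  orthonormal : ∀ j l, σ j ≠ 0 → σ l ≠ 0 → (V.transpose * V) j l = if j = l then 1 else 0
  eq : A = U * Matrix.diagonal σ * V.transpose

/-- `U` and `σ` are the mode-specific left singular vectors and singular values of `X`, that is,
the ingredients of the HOSVD `X = U · S`. -/
def IsHOSVD (X : Tensor p) (U : Factors p) (σ : ∀ k : Fin K, Fin (p k) → ℝ) : Prop :=
  ∀ k, ∃ V, IsSVD (unfold k X) (U k) (σ k) V

/-- The core array `S = Uᵀ · X`. -/
def core (U : Factors p) (X : Tensor p) : Tensor p :=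
  tucker (fun k => (U k).transpose) X

/-- Entrywise shrinkage, `(g(S))_i = g_i(S_i)`. -/
def shrink (g : Idx p → ℝ → ℝ) (S : Tensor p) : Tensor p :=
  WithLp.toLp 2 fun i => g i (S i)

/-- The core-shrinkage estimator `t(X) = U · g(S)`, for a choice `U` of the factors as a function
of the data. -/
def estimator (U : Tensor p → Factors p) (g : Idx p → ℝ → ℝ) (X : Tensor p) : Tensor p :=
  tucker (U X) (shrink g (core (U X) X))

/-- The divergence `∑_i ∂t_i/∂X_i`. -/
def divergence (t : Tensor p → Tensor p) (X : Tensor p) : ℝ :=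
  ∑ i : Idx p, (fderiv ℝ t X (EuclideanSpace.single i 1)) i

/-- Stein's unbiased risk estimate for the Gaussian mean problem with noise variance `τ²`. -/
def sure (τ : ℝ) (t : Tensor p → Tensor p) (X : Tensor p) : ℝ :=
  -((∏ k, p k : ℕ) : ℝ) * τ ^ 2 + ‖t X - X‖ ^ 2 + 2 * τ ^ 2 * divergence t X

/-- The closed form of the divergence, in terms of the core `S`, the mode-specific singular values
and the shrinkage functions. `Function.update i k j` is `(i_1, …, i_{k-1}, j, i_{k+1}, …, i_K)`. -/
def divergenceFormula (g : Idx p → ℝ → ℝ) (S : Tensor p) (σ : ∀ k : Fin K, Fin (p k) → ℝ) : ℝ :=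
  ∑ i : Idx p,
    (S i * g i (S i) *
        (∑ k, ∑ j ∈ Finset.univ.erase (i k), 1 / (σ k (i k) ^ 2 - σ k j ^ 2))
      + deriv (g i) (S i) *
        (1 + ∑ k, ∑ j ∈ Finset.univ.erase (i k),
          S (Function.update i k j) ^ 2 / (σ k (i k) ^ 2 - σ k j ^ 2)))

end HOSVD

end

/-!
The HOSVD factors of `Y` are the ordered eigenvector matrices of the Gram matrices
`gram k Y = Y_(k) * Y_(k)ᵀ` (`isHOSVD_iff`), and at `X` all the eigenvalues `σ k j ^ 2` are simple.
Everything is compared with `X` in coordinates rotated by `U₀`: the core `core U₀ Y` has the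
relative factors `M Y = U₀ᵀ * U Y`, with `M X = 1`, and its Gram matrices are diagonal at `Y = X`.

Continuity. If the signs of the singular vectors are chosen so that `M Y` has nonnegative diagonal
entries, then `M Y → 1`: a limit point of `M` is an orthogonal matrix that intertwines two ordered
diagonal matrices, the first with distinct entries, and so it is the identity
(`tendsto_one_of_eigenvectors`). This gives a choice of factors that is continuous at `X`, and for
odd `g` every choice has the same estimator as its sign-aligned version (`estimator_alignSigns`).

Differentiability. Let `B` be a rotated Gram matrix, `V` its eigenvector matrix and `c` its
eigenvalues. The entries of `B * V = V * diag c` satisfy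
`V i j * (c j - B i i) = ∑ l ≠ i, B i l * V l j`. As `B i l` vanishes at `X`, mere continuity of `V`
and `c` at `X` makes the right side differentiable there, so that
`dV i j = dB i j / (σ j ^ 2 - σ i ^ 2)` for `i ≠ j`; the diagonal derivatives vanish since the
columns are unit vectors (`hasFDerivAt_eigenvectors`).

Divergence. The divergence is the trace of the derivative, which can be computed in the rotated
coordinate directions (`differentiableAt_tucker_comp_and_divergence`). In the direction of index
`i`, the derivative of the entry `(i k, a)`, `a ≠ i k`, of the `k`-th Gram matrix is the core entry at
`Function.update i k a` (`gramDeriv_apply_of_ne`). Inserting this in the product rule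
(`hasFDerivAt_tucker_shrink_core`) and exchanging the two indices in the term that carries the
variation of the outer factors (`sum_update_comm`) gives the closed form.
-/

noncomputable section

namespace HOSVD

variable {K : ℕ} {p : Fin K → ℕ} {E : Type*} [NormedAddCommGroup E] [NormedSpace ℝ E]

/-! ### Orthogonal matrices -/

theorem mul_transpose_of_mem_orthogonalGroup {n : Type*} [Fintype n] [DecidableEq n]
    {U : Matrix n n ℝ} (h : U ∈ Matrix.orthogonalGroup n ℝ) : U * U.transpose = 1 := by
  simpa [Matrix.star_eq_conjTranspose] using (Matrix.mem_orthogonalGroup_iff n ℝ).1 h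

theorem transpose_mul_of_mem_orthogonalGroup {n : Type*} [Fintype n] [DecidableEq n]
    {U : Matrix n n ℝ} (h : U ∈ Matrix.orthogonalGroup n ℝ) : U.transpose * U = 1 := by
  simpa [Matrix.star_eq_conjTranspose] using (Matrix.mem_orthogonalGroup_iff' n ℝ).1 h

theorem mem_orthogonalGroup_of_transpose_mul {n : Type*} [Fintype n] [DecidableEq n]
    {U : Matrix n n ℝ} (h : U.transpose * U = 1) : U ∈ Matrix.orthogonalGroup n ℝ := by
  rw [Matrix.mem_orthogonalGroup_iff']
  simpa [Matrix.star_eq_conjTranspose] using h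

theorem transpose_mem_orthogonalGroup {n : Type*} [Fintype n] [DecidableEq n]
    {U : Matrix n n ℝ} (h : U ∈ Matrix.orthogonalGroup n ℝ) :
    U.transpose ∈ Matrix.orthogonalGroup n ℝ :=
  mem_orthogonalGroup_of_transpose_mul
    (by rw [Matrix.transpose_transpose]; exact mul_transpose_of_mem_orthogonalGroup h)

/-! ### Singular value decompositions and Gram matrices -/

/-- `U` orthogonally diagonalizes `B`, with eigenvalues `c ^ 2` for an ordered nonnegative `c`.
For `B = A * Aᵀ` this says that `U` and `c` are the left singular vectors and the singular
values of `A`. -/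
structure IsSqEig {m : ℕ} (B U : Matrix (Fin m) (Fin m) ℝ) (c : Fin m → ℝ) : Prop where
  orthogonal : U ∈ Matrix.orthogonalGroup (Fin m) ℝ
  nonneg : ∀ j, 0 ≤ c j
  antitone : Antitone c
  eq : B = U * Matrix.diagonal (fun j => c j ^ 2) * U.transpose

theorem IsSVD.isSqEig {m : ℕ} {n : Type} [Fintype n] {A : Matrix (Fin m) n ℝ}
    {U : Matrix (Fin m) (Fin m) ℝ} {c : Fin m → ℝ} {V : Matrix n (Fin m) ℝ}
    (h : IsSVD A U c V) : IsSqEig (A * A.transpose) U c := by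
  refine ⟨h.orthogonal, h.nonneg, h.antitone, ?_⟩
  have key : Matrix.diagonal c * (V.transpose * V) * Matrix.diagonal c
      = Matrix.diagonal (fun j => c j ^ 2) := by
    ext j l
    rw [Matrix.mul_diagonal, Matrix.diagonal_mul, Matrix.diagonal_apply]
    by_cases hj : c j = 0
    · simp [hj]
    by_cases hl : c l = 0
    · by_cases hjl : j = l
      · subst hjl; exact absurd hl hj
      · simp [hl, hjl]
    rw [h.orthonormal j l hj hl]
    by_cases hjl : j = l
    · subst hjl; simp [sq]
    · simp [hjl]
  conv_lhs => rw [h.eq]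
  rw [← key]
  simp only [Matrix.transpose_mul, Matrix.diagonal_transpose, Matrix.transpose_transpose,
    Matrix.mul_assoc]

/-- The right singular vectors are the rescaled columns of `Aᵀ * U`; those that belong to vanishing
singular values are set to zero. -/
theorem IsSqEig.exists_isSVD {m : ℕ} {n : Type} [Fintype n] {A : Matrix (Fin m) n ℝ}
    {U : Matrix (Fin m) (Fin m) ℝ} {c : Fin m → ℝ}
    (h : IsSqEig (A * A.transpose) U c) : ∃ V, IsSVD A U c V := by
  have hU := transpose_mul_of_mem_orthogonalGroup h.orthogonal
  have hU' := mul_transpose_of_mem_orthogonalGroup h.orthogonal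
  obtain ⟨D, hD⟩ : ∃ D, D = U.transpose * A := ⟨_, rfl⟩
  have hA : A = U * D := by rw [hD, ← Matrix.mul_assoc, hU', Matrix.one_mul]
  have hDD : D * D.transpose = Matrix.diagonal (fun j => c j ^ 2) := by
    have h1 : D * D.transpose = U.transpose * (A * A.transpose) * U := by
      rw [hD, Matrix.transpose_mul, Matrix.transpose_transpose]
      simp only [Matrix.mul_assoc]
    rw [h1, h.eq]
    calc _ = (U.transpose * U) * Matrix.diagonal (fun j => c j ^ 2) * (U.transpose * U) := by
          simp only [Matrix.mul_assoc]
      _ = _ := by rw [hU, Matrix.one_mul, Matrix.mul_one]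
  have hzero : ∀ j, c j = 0 → ∀ r, D j r = 0 := by
    intro j hj
    have h1 := congrFun (congrFun hDD j) j
    rw [Matrix.mul_apply, Matrix.diagonal_apply_eq, hj] at h1
    simp only [Matrix.transpose_apply, ne_eq, OfNat.ofNat_ne_zero, not_false_eq_true,
      zero_pow] at h1
    rw [Finset.sum_eq_zero_iff_of_nonneg (fun r _ => mul_self_nonneg _)] at h1
    intro r
    exact mul_self_eq_zero.1 (h1 r (Finset.mem_univ r))
  refine ⟨D.transpose * Matrix.diagonal (fun j => (c j)⁻¹),
    h.orthogonal, h.nonneg, h.antitone, ?_, ?_⟩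
  · intro j l hj hl
    have h1 : (D.transpose * Matrix.diagonal (fun j => (c j)⁻¹)).transpose *
        (D.transpose * Matrix.diagonal (fun j => (c j)⁻¹)) =
        Matrix.diagonal (fun j => (c j)⁻¹) * (D * D.transpose) *
          Matrix.diagonal (fun j => (c j)⁻¹) := by
      simp only [Matrix.transpose_mul, Matrix.diagonal_transpose, Matrix.transpose_transpose,
        Matrix.mul_assoc]
    rw [h1, hDD, Matrix.mul_diagonal, Matrix.diagonal_mul, Matrix.diagonal_apply]
    by_cases hjl : j = l
    · subst hjl; simp only [if_true]; field_simp
    · simp [hjl]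
  · conv_lhs => rw [hA]
    rw [Matrix.mul_assoc]
    congr 1
    ext j r
    rw [Matrix.diagonal_mul, Matrix.transpose_apply, Matrix.mul_diagonal, Matrix.transpose_apply]
    by_cases hj : c j = 0
    · simp [hj, hzero j hj r]
    · field_simp

/-- Sorted version of the spectral theorem, for `A * Aᵀ`. -/
theorem exists_isSqEig {m : ℕ} {n : Type} [Fintype n] (A : Matrix (Fin m) n ℝ) :
    ∃ U c, IsSqEig (A * A.transpose) U c := by
  have hpsd : (A * A.transpose).PosSemidef := by
    simpa using Matrix.posSemidef_self_mul_conjTranspose A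
  have hsp := hpsd.1.spectral_theorem
  set W : Matrix (Fin m) (Fin m) ℝ := (hpsd.1.eigenvectorUnitary).val with hW
  have hWo : W ∈ Matrix.orthogonalGroup (Fin m) ℝ := hpsd.1.eigenvectorUnitary.2
  have hsp' : A * A.transpose = W * Matrix.diagonal hpsd.1.eigenvalues * W.transpose := by
    conv_lhs => rw [hsp]
    rw [Unitary.conjStarAlgAut_apply]
    simp [Matrix.star_eq_conjTranspose, hW]
  set π := Tuple.sort (fun j => - hpsd.1.eigenvalues j)
  have hπ := Tuple.monotone_sort (fun j => - hpsd.1.eigenvalues j)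
  refine ⟨W.submatrix id π, fun j => Real.sqrt (hpsd.1.eigenvalues (π j)), ?_, ?_, ?_, ?_⟩
  · apply mem_orthogonalGroup_of_transpose_mul
    rw [Matrix.transpose_submatrix, ← Matrix.submatrix_mul _ _ _ _ _ Function.bijective_id,
      transpose_mul_of_mem_orthogonalGroup hWo, Matrix.submatrix_one_equiv]
  · intro j; exact Real.sqrt_nonneg _
  · intro i j hij
    apply Real.sqrt_le_sqrt
    have := hπ hij
    simp only [Function.comp_apply, neg_le_neg_iff] at this
    exact this
  · have h1 : (Matrix.diagonal fun j => Real.sqrt (hpsd.1.eigenvalues (π j)) ^ 2) =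
        (Matrix.diagonal hpsd.1.eigenvalues).submatrix π π := by
      rw [Matrix.submatrix_diagonal_equiv]
      congr 1
      ext j
      exact Real.sq_sqrt (hpsd.eigenvalues_nonneg _)
    rw [h1, Matrix.transpose_submatrix, Matrix.submatrix_mul_equiv, Matrix.submatrix_mul_equiv,
      ← hsp']
    simp

/-- The Gram matrix `X_(k) * X_(k)ᵀ` of the mode-`k` matricization. -/
def gram (k : Fin K) (X : Tensor p) : Matrix (Fin (p k)) (Fin (p k)) ℝ :=
  unfold k X * (unfold k X).transpose

theorem isHOSVD_iff {X : Tensor p} {U : Factors p} {σ : ∀ k : Fin K, Fin (p k) → ℝ} :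
    IsHOSVD X U σ ↔ ∀ k, IsSqEig (gram k X) (U k) (σ k) :=
  forall_congr' fun _ => ⟨fun ⟨_, h⟩ => h.isSqEig, fun h => h.exists_isSVD⟩

theorem exists_isHOSVD (X : Tensor p) : ∃ U σ, IsHOSVD X U σ := by
  choose U σ h using fun k => exists_isSqEig (unfold k X)
  exact ⟨U, σ, isHOSVD_iff.2 h⟩

/-! ### Continuity of eigenvectors -/

/-- An orthogonal matrix that intertwines two ordered diagonal matrices is the identity if the first
of them has distinct entries and the matrix has a nonnegative diagonal: by distinctness each column
has exactly one nonzero entry, and the permutation so defined preserves the order. -/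
theorem eq_one_of_diagonal_mul_eq {m : ℕ} {V : Matrix (Fin m) (Fin m) ℝ} {a b : Fin m → ℝ}
    (hV : V ∈ Matrix.orthogonalGroup (Fin m) ℝ) (ha : StrictAnti a) (hb : Antitone b)
    (hab : Matrix.diagonal a * V = V * Matrix.diagonal b) (hdiag : ∀ j, 0 ≤ V j j) : V = 1 := by
  have hVV := transpose_mul_of_mem_orthogonalGroup hV
  have hcol : ∀ j l, ∑ i, V i j * V i l = if j = l then 1 else 0 := by
    intro j l
    have := congrFun (congrFun hVV j) l
    simpa [Matrix.mul_apply, Matrix.one_apply] using this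
  have hent : ∀ i j, V i j ≠ 0 → a i = b j := by
    intro i j hij
    have := congrFun (congrFun hab i) j
    rw [Matrix.diagonal_mul, Matrix.mul_diagonal, mul_comm] at this
    exact mul_left_cancel₀ hij this
  have hex : ∀ j, ∃ i, V i j ≠ 0 := by
    intro j
    by_contra! h
    have := hcol j j
    simp [h] at this
  choose π hπ using hex
  have huniq : ∀ i j, i ≠ π j → V i j = 0 := by
    intro i j hij
    by_contra h
    exact hij (ha.injective ((hent i j h).trans (hent _ j (hπ j)).symm))
  have hsum : ∀ j l, V (π j) j * V (π j) l = if j = l then 1 else 0 := by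
    intro j l
    rw [← hcol j l]
    symm
    apply Finset.sum_eq_single (π j)
    · intro i _ hi; rw [huniq i j hi, zero_mul]
    · simp
  have hinj : Function.Injective π := by
    intro j l hjl
    by_contra hne
    have := hsum j l
    rw [if_neg hne] at this
    rcases mul_eq_zero.1 this with h | h
    · exact hπ j h
    · rw [hjl] at h; exact hπ l h
  have hbij : Function.Bijective π := Finite.injective_iff_bijective.1 hinj
  have hanti : Antitone (a ∘ Equiv.ofBijective π hbij) := by
    have : a ∘ Equiv.ofBijective π hbij = b := by
      ext j; exact hent _ j (hπ j)
    rw [this]; exact hb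
  have hid := Tuple.unique_antitone hanti (τ := Equiv.refl _) (f := a) ha.antitone
  have hπid : ∀ j, π j = j := fun j => ha.injective (congrFun hid j)
  ext i j
  rw [Matrix.one_apply]
  split_ifs with hij
  · subst hij
    have h1 := hsum i i
    rw [hπid, if_pos rfl] at h1
    nlinarith [hdiag i]
  · exact huniq i j (by rw [hπid]; exact hij)

/-- Continuity of ordered eigenvectors at a matrix with simple spectrum, the signs being fixed by a
nonnegative diagonal. Every limit point of the eigenvector matrices is, by compactness, an orthogonal
matrix of eigenvectors of the limit, hence the identity. -/
theorem tendsto_one_of_eigenvectors {α : Type*} {m : ℕ} {l : Filter α}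
    {B V : α → Matrix (Fin m) (Fin m) ℝ} {c : α → Fin m → ℝ} {a : Fin m → ℝ}
    (ha : StrictAnti a) (hB : Tendsto B l (𝓝 (Matrix.diagonal a)))
    (hV : ∀ᶠ y in l, V y ∈ Matrix.orthogonalGroup (Fin m) ℝ)
    (hc : ∀ᶠ y in l, Antitone (c y))
    (hBV : ∀ᶠ y in l, B y = V y * Matrix.diagonal (c y) * (V y).transpose)
    (hdiag : ∀ᶠ y in l, ∀ j, 0 ≤ V y j j) : Tendsto V l (𝓝 1) := by
  rw [tendsto_iff_ultrafilter]
  intro f hf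
  have hK : IsCompact (Set.univ.pi fun _ : Fin m => Set.univ.pi fun _ : Fin m =>
      Set.Icc (-1 : ℝ) 1) :=
    isCompact_univ_pi fun _ => isCompact_univ_pi fun _ => isCompact_Icc
  obtain ⟨W, -, hW⟩ : ∃ W : Matrix (Fin m) (Fin m) ℝ, W ∈ _ ∧ _ :=
    hK.ultrafilter_le_nhds (f.map V) (by
    rw [le_principal_iff]
    filter_upwards [hf hV] with y hy i _ j _
    have := entry_norm_bound_of_unitary (𝕜 := ℝ) hy i j
    rwa [Real.norm_eq_abs, abs_le] at this)
  have hVW : Tendsto V f (𝓝 W) := hW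
  have hBf : Tendsto B f (𝓝 (Matrix.diagonal a)) := hB.mono_left hf
  have hVT : Tendsto (fun y => (V y).transpose) f (𝓝 W.transpose) :=
    (Continuous.matrix_transpose continuous_id).continuousAt.tendsto.comp hVW
  have hWo : W.transpose * W = 1 := by
    refine tendsto_nhds_unique (hVT.mul hVW) (tendsto_const_nhds.congr' ?_)
    filter_upwards [hf hV] with y hy
    exact (transpose_mul_of_mem_orthogonalGroup hy).symm
  have hWm := mem_orthogonalGroup_of_transpose_mul hWo
  have hlim : Tendsto (fun y => Matrix.diagonal (c y)) f
      (𝓝 (W.transpose * Matrix.diagonal a * W)) := by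
    refine ((hVT.mul hBf).mul hVW).congr' ?_
    filter_upwards [hf hV, hf hBV] with y hy hBy
    have h1 := transpose_mul_of_mem_orthogonalGroup hy
    rw [hBy]
    calc _ = ((V y).transpose * V y) * Matrix.diagonal (c y) * ((V y).transpose * V y) := by
          simp only [Matrix.mul_assoc]
      _ = _ := by rw [h1, Matrix.one_mul, Matrix.mul_one]
  have hlim' : ∀ i j, Tendsto (fun y => Matrix.diagonal (c y) i j) f
      (𝓝 ((W.transpose * Matrix.diagonal a * W) i j)) := fun i j =>
    tendsto_pi_nhds.1 (tendsto_pi_nhds.1 hlim i) j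
  set b : Fin m → ℝ := fun j => (W.transpose * Matrix.diagonal a * W) j j with hb
  have hlimb : ∀ j, Tendsto (fun y => c y j) f (𝓝 (b j)) := by
    intro j
    simpa using hlim' j j
  have hbanti : Antitone b := by
    intro i j hij
    refine le_of_tendsto_of_tendsto (hlimb j) (hlimb i) ?_
    filter_upwards [hf hc] with y hy using hy hij
  have hbeq : W.transpose * Matrix.diagonal a * W = Matrix.diagonal b := by
    ext i j
    rw [Matrix.diagonal_apply]
    split_ifs with hij
    · subst hij; rfl
    · refine tendsto_nhds_unique (hlim' i j) (tendsto_const_nhds.congr fun y => ?_)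
      rw [Matrix.diagonal_apply_ne _ hij]
  have hW1 : W = 1 := by
    refine eq_one_of_diagonal_mul_eq hWm ha hbanti ?_ ?_
    · rw [← hbeq]
      calc _ = (W * W.transpose) * Matrix.diagonal a * W := by
            rw [mul_transpose_of_mem_orthogonalGroup hWm, Matrix.one_mul]
        _ = _ := by simp only [Matrix.mul_assoc]
    · intro j
      refine ge_of_tendsto (tendsto_pi_nhds.1 (tendsto_pi_nhds.1 hVW j) j) ?_
      filter_upwards [hf hdiag] with y hy using hy j
  rw [← hW1]
  exact hVW

/-! ### First-order perturbation of eigenvectors -/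

/-- A product is differentiable at a zero of a differentiable factor if the other factor is
merely continuous there. -/
theorem hasFDerivAt_mul_of_eq_zero {f h : E → ℝ} {f' : E →L[ℝ] ℝ} {x : E}
    (hf : HasFDerivAt f f' x) (hfx : f x = 0) (hh : ContinuousAt h x) :
    HasFDerivAt (fun y => f y * h y) (h x • f') x := by
  rw [hasFDerivAt_iff_isLittleO]
  have h1 := hf.isLittleO.norm_right.mul_isBigO (hh.isBigO_one ℝ)
  have h2 : (fun y => h y - h x) =o[𝓝 x] fun _ => (1 : ℝ) := by
    rw [Asymptotics.isLittleO_one_iff]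
    simpa using hh.tendsto.sub_const (h x)
  have h3 := (f'.isBigO_sub (𝓝 x) x).norm_right.mul_isLittleO h2
  have h4 := h1.add h3
  simp only [mul_one] at h4
  refine h4.of_norm_right.congr_left fun y => ?_
  simp [hfx]
  ring

/-- First-order perturbation of eigenvectors at a diagonal matrix with simple spectrum. Only
continuity of the eigenvectors is assumed: comparing the entries of `B * V = V * diag c` gives
`V i j * (c j - B i i) = ∑ l ≠ i, B i l * V l j`, and the off-diagonal entries `B i l` vanish at the
base point. -/
theorem hasFDerivAt_eigenvectors {m : ℕ} {B V : E → Matrix (Fin m) (Fin m) ℝ}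
    {c : E → Fin m → ℝ} {a : Fin m → ℝ} {x : E} {B' : Fin m → Fin m → E →L[ℝ] ℝ}
    (ha : Function.Injective a) (hB : ∀ i j, HasFDerivAt (fun y => B y i j) (B' i j) x)
    (hBx : B x = Matrix.diagonal a) (hVx : V x = 1) (hVc : ContinuousAt V x)
    (hV : ∀ᶠ y in 𝓝 x, V y ∈ Matrix.orthogonalGroup (Fin m) ℝ)
    (hBV : ∀ᶠ y in 𝓝 x, B y = V y * Matrix.diagonal (c y) * (V y).transpose) (i j : Fin m) :
    HasFDerivAt (fun y => V y i j) (if i = j then 0 else (a j - a i)⁻¹ • B' i j) x := by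
  have hVc' : ∀ i j, ContinuousAt (fun y => V y i j) x := fun i j =>
    tendsto_pi_nhds.1 (tendsto_pi_nhds.1 hVc i) j
  have hBc : ∀ i j, ContinuousAt (fun y => B y i j) x := fun i j => (hB i j).continuousAt
  have hBVm : ∀ᶠ y in 𝓝 x, B y * V y = V y * Matrix.diagonal (c y) := by
    filter_upwards [hV, hBV] with y hy hBy
    rw [hBy, Matrix.mul_assoc, transpose_mul_of_mem_orthogonalGroup hy, Matrix.mul_one]
  have hoff : ∀ i j, i ≠ j → HasFDerivAt (fun y => V y i j) ((a j - a i)⁻¹ • B' i j) x := by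
    intro i j hij
    -- The eigenvalue is recovered from `V` and `B`, so it is continuous as well.
    set d : E → ℝ := fun y => ∑ l, ∑ r, V y l j * B y l r * V y r j with hd
    have hdc : ContinuousAt d x := by
      refine tendsto_finsetSum _ fun l _ => tendsto_finsetSum _ fun r _ => ?_
      exact ((hVc' l j).mul (hBc l r)).mul (hVc' r j)
    have hdx : d x = a j := by
      simp [hd, hVx, hBx, Matrix.one_apply]
    have hcd : ∀ᶠ y in 𝓝 x, c y j = d y := by
      filter_upwards [hV, hBVm] with y hy hBy
      have h1 : ((V y).transpose * (B y * V y)) j j = c y j := by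
        rw [hBy, ← Matrix.mul_assoc, transpose_mul_of_mem_orthogonalGroup hy, Matrix.one_mul,
          Matrix.diagonal_apply_eq]
      rw [← h1]
      simp only [Matrix.mul_apply, Matrix.transpose_apply, hd, Finset.mul_sum, mul_assoc]
    have hne : d x - B x i i ≠ 0 := by
      rw [hdx, hBx, Matrix.diagonal_apply_eq, sub_ne_zero]
      exact fun h => hij (ha h).symm
    have hdiff : ContinuousAt (fun y => d y - B y i i) x := hdc.sub (hBc i i)
    have hrepr : ∀ᶠ y in 𝓝 x, V y i j =
        (∑ l ∈ Finset.univ.erase i, B y i l * V y l j) * (d y - B y i i)⁻¹ := by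
      filter_upwards [hBVm, hcd, hdiff.eventually_ne hne] with y hy hcy hney
      have h1 := congrFun (congrFun hy i) j
      rw [Matrix.mul_diagonal, Matrix.mul_apply, hcy,
        ← Finset.add_sum_erase _ _ (Finset.mem_univ i)] at h1
      rw [eq_mul_inv_iff_mul_eq₀ hney]
      linarith
    have hsum : HasFDerivAt (fun y => ∑ l ∈ Finset.univ.erase i, B y i l * V y l j)
        (∑ l ∈ Finset.univ.erase i, V x l j • B' i l) x := by
      refine HasFDerivAt.fun_sum fun l hl => ?_
      refine hasFDerivAt_mul_of_eq_zero (hB i l) ?_ (hVc' l j)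
      rw [hBx, Matrix.diagonal_apply_ne' _ (Finset.ne_of_mem_erase hl)]
    have hsum' : ∑ l ∈ Finset.univ.erase i, V x l j • B' i l = B' i j := by
      rw [Finset.sum_eq_single j]
      · simp [hVx]
      · intro l _ hl; simp [hVx, Matrix.one_apply_ne hl]
      · intro h; exact absurd (Finset.mem_erase.2 ⟨hij.symm, Finset.mem_univ j⟩) h
    rw [hsum'] at hsum
    have hzero : ∑ l ∈ Finset.univ.erase i, B x i l * V x l j = 0 := by
      refine Finset.sum_eq_zero fun l hl => ?_
      rw [hBx, Matrix.diagonal_apply_ne' _ (Finset.ne_of_mem_erase hl), zero_mul]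
    have h := hasFDerivAt_mul_of_eq_zero hsum hzero (hdiff.inv₀ hne)
    rw [Pi.inv_apply, hdx, hBx, Matrix.diagonal_apply_eq] at h
    exact h.congr_of_eventuallyEq hrepr
  split_ifs with hij
  · subst hij
    -- Columns have norm one, so `V i i - 1 = -(∑ l ≠ i, V l i ^ 2) / (1 + V i i)`.
    have hne : 1 + V x i i ≠ 0 := by rw [hVx, Matrix.one_apply_eq]; norm_num
    have hcont : ContinuousAt (fun y => 1 + V y i i) x := continuousAt_const.add (hVc' i i)
    have hrepr : ∀ᶠ y in 𝓝 x, V y i i =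
        1 - (∑ l ∈ Finset.univ.erase i, V y l i * V y l i) * (1 + V y i i)⁻¹ := by
      filter_upwards [hV, hcont.eventually_ne hne] with y hy hney
      have h1 := congrFun (congrFun (transpose_mul_of_mem_orthogonalGroup hy) i) i
      rw [Matrix.mul_apply, Matrix.one_apply_eq,
        ← Finset.add_sum_erase _ _ (Finset.mem_univ i)] at h1
      simp only [Matrix.transpose_apply] at h1
      rw [eq_sub_iff_add_eq, ← eq_sub_iff_add_eq', mul_inv_eq_iff_eq_mul₀ hney]
      linear_combination h1
    have hvan : ∀ l ∈ Finset.univ.erase i, V x l i = 0 := fun l hl => by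
      rw [hVx, Matrix.one_apply_ne (Finset.ne_of_mem_erase hl)]
    have hsum : HasFDerivAt (fun y => ∑ l ∈ Finset.univ.erase i, V y l i * V y l i)
        (0 : E →L[ℝ] ℝ) x := by
      have h : ∀ l ∈ Finset.univ.erase i, HasFDerivAt (fun y => V y l i * V y l i)
        (0 : E →L[ℝ] ℝ) x := by
        intro l hl
        have h1 := hasFDerivAt_mul_of_eq_zero (hoff l i (Finset.ne_of_mem_erase hl)) (hvan l hl)
          (hVc' l i)
        rwa [hvan l hl, zero_smul] at h1
      simpa using HasFDerivAt.fun_sum h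
    have h := (hasFDerivAt_mul_of_eq_zero hsum
      (Finset.sum_eq_zero fun l hl => by rw [hvan l hl, zero_mul]) (hcont.inv₀ hne)).const_sub 1
    simp only [smul_zero, neg_zero] at h
    exact h.congr_of_eventuallyEq hrepr
  · exact hoff i j hij

/-! ### The Tucker product -/

theorem tucker_apply (A : Factors p) (X : Tensor p) (i : Idx p) :
    tucker A X i = ∑ j : Idx p, (∏ k, A k (i k) (j k)) * X j := rfl

theorem shrink_apply (g : Idx p → ℝ → ℝ) (S : Tensor p) (i : Idx p) :
    shrink g S i = g i (S i) := rfl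

theorem tucker_tucker (A B : Factors p) (X : Tensor p) :
    tucker A (tucker B X) = tucker (fun k => A k * B k) X := by
  ext i
  simp only [tucker_apply, Matrix.mul_apply, Fintype.prod_sum, Finset.mul_sum, Finset.sum_mul,
    Finset.prod_mul_distrib]
  rw [Finset.sum_comm]
  simp only [mul_assoc]

theorem prod_diagonal_apply (s : ∀ k, Fin (p k) → ℝ) (i j : Idx p) :
    ∏ k, Matrix.diagonal (s k) (i k) (j k) = if i = j then ∏ k, s k (i k) else 0 := by
  split_ifs with h
  · subst h; simp
  · obtain ⟨k, hk⟩ := Function.ne_iff.1 h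
    exact Finset.prod_eq_zero (Finset.mem_univ k) (Matrix.diagonal_apply_ne _ hk)

theorem tucker_diagonal_apply (s : ∀ k, Fin (p k) → ℝ) (X : Tensor p) (i : Idx p) :
    tucker (fun k => Matrix.diagonal (s k)) X i = (∏ k, s k (i k)) * X i := by
  simp [tucker_apply, prod_diagonal_apply]

theorem tucker_one (X : Tensor p) : tucker (fun _ => 1) X = X := by
  ext i
  simpa using tucker_diagonal_apply (fun _ _ => 1) X i

theorem tucker_transpose_tucker {A : Factors p}
    (hA : ∀ k, A k ∈ Matrix.orthogonalGroup (Fin (p k)) ℝ) (X : Tensor p) :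
    tucker (fun k => (A k).transpose) (tucker A X) = X := by
  simp only [tucker_tucker, transpose_mul_of_mem_orthogonalGroup (hA _), tucker_one]

theorem tucker_tucker_transpose {A : Factors p}
    (hA : ∀ k, A k ∈ Matrix.orthogonalGroup (Fin (p k)) ℝ) (X : Tensor p) :
    tucker A (tucker (fun k => (A k).transpose) X) = X := by
  simp only [tucker_tucker, mul_transpose_of_mem_orthogonalGroup (hA _), tucker_one]

/-- The Tucker product with fixed factors, as a linear map. -/
def tuckerLM (A : Factors p) : Tensor p →ₗ[ℝ] Tensor p where
  toFun := tucker A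
  map_add' X Y := by
    ext i
    simp [tucker_apply, mul_add, Finset.sum_add_distrib]
  map_smul' c X := by
    ext i
    simp only [tucker_apply, PiLp.smul_apply, smul_eq_mul, RingHom.id_apply, Finset.mul_sum]
    exact Finset.sum_congr rfl fun j _ => by ring

theorem tuckerLM_apply (A : Factors p) (X : Tensor p) : tuckerLM A X = tucker A X := rfl

theorem inner_tucker (A : Factors p) (X Y : Tensor p) :
    inner ℝ (tucker A X) Y = inner ℝ X (tucker (fun k => (A k).transpose) Y) := by
  simp only [PiLp.inner_apply, tucker_apply, RCLike.inner_apply, conj_trivial, Finset.mul_sum,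
    Finset.sum_mul, Matrix.transpose_apply]
  rw [Finset.sum_comm]
  exact Finset.sum_congr rfl fun i _ => Finset.sum_congr rfl fun j _ => by ring

theorem norm_tucker {A : Factors p}
    (hA : ∀ k, A k ∈ Matrix.orthogonalGroup (Fin (p k)) ℝ) (X : Tensor p) :
    ‖tucker A X‖ = ‖X‖ := by
  rw [← sq_eq_sq₀ (norm_nonneg _) (norm_nonneg _), ← real_inner_self_eq_norm_sq,
    ← real_inner_self_eq_norm_sq, inner_tucker, tucker_transpose_tucker hA]

/-- The matricization of a Tucker product is a matrix product whose right factor is the Kronecker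
product of the remaining matrices. -/
theorem unfold_tucker (k : Fin K) (A : Factors p) (X : Tensor p) :
    unfold k (tucker A X) = A k * unfold k X *
      (Matrix.of fun r s : ∀ l : {l : Fin K // l ≠ k}, Fin (p l) =>
        ∏ l : {l : Fin K // l ≠ k}, A l (r l) (s l)).transpose := by
  ext a r
  rw [Matrix.mul_apply]
  simp only [unfold, Matrix.mul_apply, Matrix.of_apply, Matrix.transpose_apply, tucker_apply]
  rw [← (Equiv.piSplitAt k fun l => Fin (p l)).symm.sum_comp, Fintype.sum_prod_type,
    Finset.sum_comm]
  refine Finset.sum_congr rfl fun s _ => ?_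
  rw [Finset.sum_mul]
  refine Finset.sum_congr rfl fun b _ => ?_
  rw [Fintype.prod_eq_mul_prod_subtype_ne _ k]
  have h1 : ∀ (c : Fin (p k)) (t : ∀ l : {l : Fin K // l ≠ k}, Fin (p l)),
      (Equiv.piSplitAt k fun l => Fin (p l)).symm (c, t) k = c := by
    intro c t; simp [Equiv.piSplitAt]
  have h2 : ∀ (c : Fin (p k)) (t : ∀ l : {l : Fin K // l ≠ k}, Fin (p l))
      (l : {l : Fin K // l ≠ k}),
      (Equiv.piSplitAt k fun l => Fin (p l)).symm (c, t) l = t l := by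
    intro c t l; simp [Equiv.piSplitAt, l.2]
  simp only [h1, h2]
  ring

theorem gram_tucker {A : Factors p}
    (hA : ∀ k, A k ∈ Matrix.orthogonalGroup (Fin (p k)) ℝ) (k : Fin K) (X : Tensor p) :
    gram k (tucker A X) = A k * gram k X * (A k).transpose := by
  set W := Matrix.of fun r s : ∀ l : {l : Fin K // l ≠ k}, Fin (p l) =>
    ∏ l : {l : Fin K // l ≠ k}, A l (r l) (s l) with hW
  have hWW : W.transpose * W = 1 := by
    ext r s
    simp only [Matrix.mul_apply, Matrix.transpose_apply, hW, Matrix.of_apply,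
      ← Finset.prod_mul_distrib]
    rw [← Fintype.prod_sum fun (l : {l : Fin K // l ≠ k}) (j : Fin (p l)) =>
      A l j (r l) * A l j (s l)]
    have h1 : ∀ l : {l : Fin K // l ≠ k},
        ∑ j, A l j (r l) * A l j (s l) = (1 : Matrix (Fin (p l)) (Fin (p l)) ℝ) (r l) (s l) := by
      intro l
      rw [← transpose_mul_of_mem_orthogonalGroup (hA l), Matrix.mul_apply]
      simp only [Matrix.transpose_apply]
    simp only [h1]
    rw [Matrix.one_apply]
    split_ifs with h
    · subst h; simp
    · obtain ⟨l, hl⟩ := Function.ne_iff.1 h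
      exact Finset.prod_eq_zero (Finset.mem_univ l) (Matrix.one_apply_ne hl)
  rw [gram, gram, unfold_tucker]
  simp only [Matrix.transpose_mul, Matrix.transpose_transpose]
  calc _ = A k * unfold k X * (W.transpose * W) * (unfold k X).transpose * (A k).transpose := by
        simp only [Matrix.mul_assoc]; rfl
    _ = _ := by rw [hWW]; simp only [Matrix.mul_assoc, Matrix.mul_one]

theorem gram_apply (k : Fin K) (X : Tensor p) (a b : Fin (p k)) :
    gram k X a b = ∑ r, X ((Equiv.piSplitAt k fun l => Fin (p l)).symm (a, r)) *
      X ((Equiv.piSplitAt k fun l => Fin (p l)).symm (b, r)) := rfl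

/-! ### Derivatives of Gram matrices and Tucker products -/

/-- The derivative of `gram k (T ·)`, in terms of the entries of `T` and their derivatives. -/
def gramDeriv (k : Fin K) (T : Tensor p) (T' : Idx p → E →L[ℝ] ℝ) (a b : Fin (p k)) :
    E →L[ℝ] ℝ :=
  ∑ r, (T ((Equiv.piSplitAt k fun l => Fin (p l)).symm (a, r)) •
      T' ((Equiv.piSplitAt k fun l => Fin (p l)).symm (b, r)) +
    T ((Equiv.piSplitAt k fun l => Fin (p l)).symm (b, r)) •
      T' ((Equiv.piSplitAt k fun l => Fin (p l)).symm (a, r)))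

theorem hasFDerivAt_gram {T : E → Tensor p} {T' : Idx p → E →L[ℝ] ℝ} {x : E}
    (hT : ∀ i, HasFDerivAt (fun y => T y i) (T' i) x) (k : Fin K) (a b : Fin (p k)) :
    HasFDerivAt (fun y => gram k (T y) a b) (gramDeriv k (T x) T' a b) x := by
  simp only [gram_apply]
  exact HasFDerivAt.fun_sum fun r _ => (hT _).mul (hT _)

theorem gramDeriv_comm (k : Fin K) (T : Tensor p) (T' : Idx p → E →L[ℝ] ℝ) (a b : Fin (p k)) :
    gramDeriv k T T' a b = gramDeriv k T T' b a :=
  Finset.sum_congr rfl fun _ _ => add_comm _ _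

/-- The derivative of an off-diagonal entry of the Gram matrix in a coordinate direction. -/
theorem gramDeriv_apply_of_ne (k : Fin K) (T : Tensor p) {T' : Idx p → E →L[ℝ] ℝ} {i : Idx p}
    {h : E} (hT' : ∀ j, T' j h = if j = i then 1 else 0) {b : Fin (p k)} (hb : b ≠ i k) :
    gramDeriv k T T' (i k) b h = T (Function.update i k b) := by
  have h1 : ∀ (c : Fin (p k)) (r : ∀ l : {l : Fin K // l ≠ k}, Fin (p l)),
      (Equiv.piSplitAt k fun l => Fin (p l)).symm (c, r) = i ↔
        c = i k ∧ r = fun l : {l : Fin K // l ≠ k} => i l := by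
    intro c r
    rw [Equiv.symm_apply_eq, Equiv.piSplitAt_apply, Prod.mk.injEq]
  have h2 : (Equiv.piSplitAt k fun l => Fin (p l)).symm (b, fun l => i l) =
      Function.update i k b := by
    rw [Equiv.symm_apply_eq, Equiv.piSplitAt_apply, Prod.mk.injEq]
    refine ⟨(Function.update_self k b i).symm, funext fun l => ?_⟩
    exact (Function.update_of_ne l.2 b i).symm
  simp [gramDeriv, hT', h1, hb, h2]

theorem sum_prod_one_apply_mul (i : Idx p) (F : Idx p → ℝ) :
    ∑ j : Idx p, (∏ k, (1 : Matrix (Fin (p k)) (Fin (p k)) ℝ) (i k) (j k)) * F j = F i := by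
  simpa only [tucker_apply] using congrArg (fun T : Tensor p => T i) (tucker_one (WithLp.toLp 2 F))

/-- The product rule for the Tucker product at identity factors. -/
theorem hasFDerivAt_tucker_apply {M : E → Factors p} {M' : ∀ k, Fin (p k) → Fin (p k) → E →L[ℝ] ℝ}
    {T : E → Tensor p} {T' : Idx p → E →L[ℝ] ℝ} {x : E}
    (hM : ∀ k a b, HasFDerivAt (fun y => M y k a b) (M' k a b) x) (hMx : ∀ k, M x k = 1)
    (hT : ∀ i, HasFDerivAt (fun y => T y i) (T' i) x) (i : Idx p) :
    HasFDerivAt (fun y => tucker (M y) (T y) i)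
      (T' i + ∑ k, ∑ a, T x (Function.update i k a) • M' k (i k) a) x := by
  simp only [tucker_apply]
  have h := HasFDerivAt.fun_sum (u := Finset.univ) fun (j : Idx p) _ =>
    (HasFDerivAt.finsetProd (u := Finset.univ) fun k _ => hM k (i k) (j k)).mul (hT j)
  refine HasFDerivAt.congr_fderiv h (ContinuousLinearMap.ext fun v => ?_)
  simp only [hMx, add_apply, sum_apply, smul_apply, smul_eq_mul, Finset.sum_add_distrib]
  symm
  rw [sum_prod_one_apply_mul i fun j => T' j v]
  congr 1
  simp only [Finset.mul_sum]
  rw [Finset.sum_comm]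
  refine Finset.sum_congr rfl fun k _ => ?_
  refine Fintype.sum_of_injective (fun a => Function.update i k a)
    (Function.update_injective i k) _ _ ?_ ?_
  · intro j hj
    have : ∃ l, l ≠ k ∧ i l ≠ j l := by
      by_contra! hcon
      refine hj ⟨j k, funext fun l => ?_⟩
      by_cases hl : l = k
      · subst hl; simp
      · simp [hl, hcon l hl]
    obtain ⟨l, hlk, hl⟩ := this
    have hz : ∏ l ∈ Finset.univ.erase k,
        (1 : Matrix (Fin (p l)) (Fin (p l)) ℝ) (i l) (j l) = 0 :=
      Finset.prod_eq_zero (Finset.mem_erase.2 ⟨hlk, Finset.mem_univ l⟩) (Matrix.one_apply_ne hl)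
    rw [hz, zero_mul, mul_zero]
  · intro a
    rw [Finset.prod_eq_one]
    · simp
    · intro l hl
      rw [Function.update_of_ne (Finset.ne_of_mem_erase hl), Matrix.one_apply_eq]

/-- Summation over pairs of multi-indices that differ only in the `k`-th entry is symmetric. -/
theorem sum_update_comm (k : Fin K) (F : Idx p → Fin (p k) → ℝ) :
    ∑ i : Idx p, ∑ j ∈ Finset.univ.erase (i k), F (Function.update i k j) (i k) =
      ∑ i : Idx p, ∑ j ∈ Finset.univ.erase (i k), F i j := by
  rw [Finset.sum_sigma', Finset.sum_sigma']
  refine Finset.sum_nbij' (fun x => ⟨Function.update x.1 k x.2, x.1 k⟩)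
    (fun x => ⟨Function.update x.1 k x.2, x.1 k⟩) ?_ ?_ ?_ ?_ ?_
  · rintro ⟨i, j⟩ h; simpa [eq_comm] using h
  · rintro ⟨i, j⟩ h; simpa [eq_comm] using h
  · rintro ⟨i, j⟩ _; simp
  · rintro ⟨i, j⟩ _; simp
  · rintro ⟨i, j⟩ _; simp

/-- The trace is invariant under the cyclic exchange of two linear maps, in coordinates. -/
theorem sum_comp_single {ι : Type*} [Fintype ι] [DecidableEq ι]
    (R f : EuclideanSpace ℝ ι →ₗ[ℝ] EuclideanSpace ℝ ι) :
    ∑ i, R (f (EuclideanSpace.single i 1)) i = ∑ i, f (R (EuclideanSpace.single i 1)) i := by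
  have h : ∀ L : EuclideanSpace ℝ ι →ₗ[ℝ] EuclideanSpace ℝ ι,
      LinearMap.trace ℝ _ L = ∑ i, L (EuclideanSpace.single i 1) i := by
    intro L
    rw [LinearMap.trace_eq_sum_inner L (EuclideanSpace.basisFun ι ℝ)]
    simp [EuclideanSpace.inner_single_left]
  have := LinearMap.trace_mul_comm ℝ R f
  rw [h, h] at this
  exact this

/-! ### Sign changes and rotations of eigenvectors -/

theorem diagonal_sq_eq_one {m : ℕ} {s : Fin m → ℝ} (hs : ∀ j, s j * s j = 1) :
    Matrix.diagonal s * Matrix.diagonal s = 1 := by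
  rw [Matrix.diagonal_mul_diagonal, ← Matrix.diagonal_one]
  exact congrArg _ (funext hs)

theorem IsSqEig.mul_diagonal {m : ℕ} {B U : Matrix (Fin m) (Fin m) ℝ} {c s : Fin m → ℝ}
    (h : IsSqEig B U c) (hs : ∀ j, s j * s j = 1) : IsSqEig B (U * Matrix.diagonal s) c := by
  refine ⟨mul_mem h.orthogonal (mem_orthogonalGroup_of_transpose_mul ?_), h.nonneg, h.antitone, ?_⟩
  · rw [Matrix.diagonal_transpose, diagonal_sq_eq_one hs]
  · have h1 : Matrix.diagonal s * Matrix.diagonal (fun j => c j ^ 2) * Matrix.diagonal s =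
        Matrix.diagonal (fun j => c j ^ 2) := by
      simp only [Matrix.diagonal_mul_diagonal]
      exact congrArg _ (funext fun j => by linear_combination c j ^ 2 * hs j)
    calc B = U * (Matrix.diagonal s * Matrix.diagonal (fun j => c j ^ 2) * Matrix.diagonal s) *
          U.transpose := by rw [h1]; exact h.eq
      _ = _ := by
        simp only [Matrix.transpose_mul, Matrix.diagonal_transpose, Matrix.mul_assoc]

/-- Rotating by a fixed orthogonal matrix turns eigenvectors of `B` into eigenvectors of the
conjugate of `B`. -/
theorem IsSqEig.transpose_mul {m : ℕ} {B U W : Matrix (Fin m) (Fin m) ℝ} {c : Fin m → ℝ}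
    (h : IsSqEig B U c) (hW : W ∈ Matrix.orthogonalGroup (Fin m) ℝ) :
    IsSqEig (W.transpose * B * W) (W.transpose * U) c := by
  refine ⟨mul_mem (transpose_mem_orthogonalGroup hW) h.orthogonal, h.nonneg, h.antitone, ?_⟩
  rw [h.eq, Matrix.transpose_mul, Matrix.transpose_transpose]
  simp only [Matrix.mul_assoc]

theorem gram_core {U : Factors p} (hU : ∀ k, U k ∈ Matrix.orthogonalGroup (Fin (p k)) ℝ)
    (k : Fin K) (X : Tensor p) : gram k (core U X) = (U k).transpose * gram k X * U k := by
  rw [core, gram_tucker fun k => transpose_mem_orthogonalGroup (hU k)]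
  simp only [Matrix.transpose_transpose]

theorem IsSqEig.transpose_mul_mul {m : ℕ} {B U : Matrix (Fin m) (Fin m) ℝ} {c : Fin m → ℝ}
    (h : IsSqEig B U c) : U.transpose * B * U = Matrix.diagonal (fun j => c j ^ 2) := by
  have := (h.transpose_mul h.orthogonal).eq
  rwa [transpose_mul_of_mem_orthogonalGroup h.orthogonal, Matrix.transpose_one, Matrix.one_mul,
    Matrix.mul_one] at this

theorem strictAnti_sq {m : ℕ} {c : Fin m → ℝ} (h0 : ∀ j, 0 ≤ c j) (ha : Antitone c)
    (hi : Function.Injective c) : StrictAnti fun j => c j ^ 2 := fun _ j hij =>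
  pow_lt_pow_left₀ (ha.strictAnti_of_injective hi hij) (h0 j) two_ne_zero

/-! ### Sign alignment of the factors -/

/-- The signs that make the diagonal of `U₀ᵀ * U` nonnegative. -/
def signs {m : ℕ} (U₀ U : Matrix (Fin m) (Fin m) ℝ) (j : Fin m) : ℝ :=
  if (U₀.transpose * U) j j < 0 then -1 else 1

theorem signs_mul_self {m : ℕ} (U₀ U : Matrix (Fin m) (Fin m) ℝ) (j : Fin m) :
    signs U₀ U j * signs U₀ U j = 1 := by
  unfold signs; split_ifs <;> norm_num

/-- The factors `U` with the signs of the singular vectors chosen so that the vectors make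
nonobtuse angles with those in `U₀`. -/
def alignSigns (U₀ U : Factors p) : Factors p :=
  fun k => U k * Matrix.diagonal (signs (U₀ k) (U k))

theorem alignSigns_self {U₀ : Factors p}
    (h : ∀ k, U₀ k ∈ Matrix.orthogonalGroup (Fin (p k)) ℝ) : alignSigns U₀ U₀ = U₀ := by
  funext k
  have h1 : signs (U₀ k) (U₀ k) = fun _ => 1 := by
    funext j
    rw [signs, transpose_mul_of_mem_orthogonalGroup (h k), Matrix.one_apply_eq, if_neg (by norm_num)]
  rw [alignSigns, h1, Matrix.diagonal_one, Matrix.mul_one]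

theorem IsHOSVD.alignSigns {Y : Tensor p} {U : Factors p} {σ : ∀ k : Fin K, Fin (p k) → ℝ}
    (h : IsHOSVD Y U σ) (U₀ : Factors p) : IsHOSVD Y (alignSigns U₀ U) σ :=
  isHOSVD_iff.2 fun k => (isHOSVD_iff.1 h k).mul_diagonal (signs_mul_self _ _)

theorem transpose_mul_alignSigns_nonneg (U₀ U : Factors p) (k : Fin K) (j : Fin (p k)) :
    0 ≤ ((U₀ k).transpose * alignSigns U₀ U k) j j := by
  rw [alignSigns, ← Matrix.mul_assoc, Matrix.mul_diagonal, signs]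
  split_ifs <;> linarith

theorem hasFDerivAt_tucker_const (A : Factors p) (x : Tensor p) (i : Idx p) :
    HasFDerivAt (fun y => tucker A y i)
      ((EuclideanSpace.proj i : Tensor p →L[ℝ] ℝ) ∘L (tuckerLM A).toContinuousLinearMap) x :=
  ((EuclideanSpace.proj i : Tensor p →L[ℝ] ℝ) ∘L
    (tuckerLM A).toContinuousLinearMap).hasFDerivAt

theorem continuousAt_gram_core (U₀ : Factors p) (X : Tensor p) (k : Fin K) :
    ContinuousAt (fun Y => gram k (core U₀ Y)) X :=
  tendsto_pi_nhds.2 fun a => tendsto_pi_nhds.2 fun b =>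
    (hasFDerivAt_gram (fun i => hasFDerivAt_tucker_const _ X i) k a b).continuousAt

/-- Sign-aligned factors are continuous where the singular values are simple. -/
theorem continuousAt_alignSigns {X : Tensor p} {U₀ : Factors p} {σ : ∀ k : Fin K, Fin (p k) → ℝ}
    (hX : IsHOSVD X U₀ σ) (hσ : ∀ k, Function.Injective (σ k)) {U : Tensor p → Factors p}
    (hU : ∀ᶠ Y in 𝓝 X, ∃ σY, IsHOSVD Y (U Y) σY) (hUX : U X = U₀) :
    ContinuousAt (fun Y => alignSigns U₀ (U Y)) X := by
  rw [isHOSVD_iff] at hX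
  have hU₀ := fun k => (hX k).orthogonal
  obtain ⟨s, hs⟩ := hU.choice
  refine tendsto_pi_nhds.2 fun k => ?_
  have hrot : ∀ᶠ Y in 𝓝 X, IsSqEig (gram k (core U₀ Y))
      ((U₀ k).transpose * alignSigns U₀ (U Y) k) (s Y k) := by
    filter_upwards [hs] with Y hY
    rw [gram_core hU₀]
    exact (isHOSVD_iff.1 (hY.alignSigns U₀) k).transpose_mul (hU₀ k)
  have hB : Tendsto (fun Y => gram k (core U₀ Y)) (𝓝 X)
      (𝓝 (Matrix.diagonal fun j => σ k j ^ 2)) := by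
    have := (continuousAt_gram_core U₀ X k).tendsto
    rwa [gram_core hU₀, (hX k).transpose_mul_mul] at this
  have h1 := tendsto_one_of_eigenvectors (c := fun Y j => s Y k j ^ 2)
    (strictAnti_sq (hX k).nonneg (hX k).antitone (hσ k)) hB
    (hrot.mono fun Y h => h.orthogonal)
    (hrot.mono fun Y h i j hij => pow_le_pow_left₀ (h.nonneg j) (h.antitone hij) 2)
    (hrot.mono fun Y h => h.eq)
    (Eventually.of_forall fun Y j => transpose_mul_alignSigns_nonneg U₀ (U Y) k j)
  have h2 := (tendsto_const_nhds (x := U₀ k)).mul h1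
  have h3 : ∀ Y, U₀ k * ((U₀ k).transpose * alignSigns U₀ (U Y) k) = alignSigns U₀ (U Y) k :=
    fun Y => by
      rw [← Matrix.mul_assoc, mul_transpose_of_mem_orthogonalGroup (hU₀ k), Matrix.one_mul]
  simp only [h3, Matrix.mul_one] at h2
  simpa only [hUX, alignSigns_self hU₀] using h2

/-- For odd shrinkage functions the signs of the singular vectors cancel. -/
theorem estimator_alignSigns {g : Idx p → ℝ → ℝ} (hg : ∀ i s, g i (-s) = -g i s)
    (U₀ : Factors p) (U : Tensor p → Factors p) :
    estimator (fun Y => alignSigns U₀ (U Y)) g = estimator U g := by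
  funext Y
  set s : ∀ k, Fin (p k) → ℝ := fun k => signs (U₀ k) (U Y k) with hs
  have hA : ∀ T : Tensor p, tucker (alignSigns U₀ (U Y)) T =
      tucker (U Y) (tucker (fun k => Matrix.diagonal (s k)) T) := fun T => by
    rw [tucker_tucker]; rfl
  have hC : ∀ T : Tensor p, core (alignSigns U₀ (U Y)) T =
      tucker (fun k => Matrix.diagonal (s k)) (core (U Y) T) := fun T => by
    rw [core, core, tucker_tucker]
    congr 1
    funext k
    rw [alignSigns, Matrix.transpose_mul, Matrix.diagonal_transpose]
  have hsgn : ∀ i : Idx p, ∏ k, s k (i k) = 1 ∨ ∏ k, s k (i k) = -1 := by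
    intro i
    rw [← mul_self_eq_one_iff, ← Finset.prod_mul_distrib]
    exact Finset.prod_eq_one fun k _ => signs_mul_self _ _ _
  simp only [estimator, hA, hC]
  congr 1
  ext i
  simp only [tucker_diagonal_apply, shrink_apply]
  rcases hsgn i with h | h
  · simp [h]
  · simp [h, hg]

/-! ### Derivative and divergence of the estimator -/

/-- In coordinates rotated by fixed orthogonal factors `U₀`, the estimator is built from the
relative factors `U₀ᵀ * U`. -/
theorem estimator_eq_tucker {U₀ : Factors p}
    (hU₀ : ∀ k, U₀ k ∈ Matrix.orthogonalGroup (Fin (p k)) ℝ) (U : Tensor p → Factors p)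
    (g : Idx p → ℝ → ℝ) (Y : Tensor p) :
    estimator U g Y = tucker U₀ (tucker (fun k => (U₀ k).transpose * U Y k)
      (shrink g (core (fun k => (U₀ k).transpose * U Y k) (core U₀ Y)))) := by
  have h1 : ∀ k, U₀ k * ((U₀ k).transpose * U Y k) = U Y k := fun k => by
    rw [← Matrix.mul_assoc, mul_transpose_of_mem_orthogonalGroup (hU₀ k), Matrix.one_mul]
  have h2 : ∀ k, ((U₀ k).transpose * U Y k).transpose * (U₀ k).transpose = (U Y k).transpose :=
    fun k => by rw [← Matrix.transpose_mul, h1]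
  simp only [estimator, core, tucker_tucker, h1, h2]

/-- A map read in coordinates rotated by `A` has as divergence the sum of its partial derivatives in
the rotated coordinate directions. -/
theorem differentiableAt_tucker_comp_and_divergence {f : Tensor p → Tensor p}
    {f' : Idx p → Tensor p →L[ℝ] ℝ} {X : Tensor p}
    (hf : ∀ i, HasFDerivAt (fun Y => f Y i) (f' i) X) (A : Factors p) :
    DifferentiableAt ℝ (fun Y => tucker A (f Y)) X ∧
      divergence (fun Y => tucker A (f Y)) X =
        ∑ i, f' i (tucker A (EuclideanSpace.single i 1)) := by
  have hfd : DifferentiableAt ℝ f X :=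
    (differentiableAt_piLp 2).2 fun i => (hf i).differentiableAt
  have hcoord : ∀ i H, fderiv ℝ f X H i = f' i H := fun i H => by
    have h1 : HasFDerivAt (fun Y => f Y i)
        ((EuclideanSpace.proj i : Tensor p →L[ℝ] ℝ) ∘L fderiv ℝ f X) X :=
      (EuclideanSpace.proj i : Tensor p →L[ℝ] ℝ).hasFDerivAt.comp X hfd.hasFDerivAt
    exact congrArg (fun L : Tensor p →L[ℝ] ℝ => L H) (h1.unique (hf i))
  have hcomp : HasFDerivAt (fun Y => tucker A (f Y))
      ((tuckerLM A).toContinuousLinearMap ∘L fderiv ℝ f X) X :=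
    (tuckerLM A).toContinuousLinearMap.hasFDerivAt.comp X hfd.hasFDerivAt
  refine ⟨hcomp.differentiableAt, ?_⟩
  rw [divergence, hcomp.fderiv]
  simp only [← hcoord]
  exact sum_comp_single (tuckerLM A) (fderiv ℝ f X).toLinearMap

/-- The derivative of `U · g(Uᵀ · C)` where the factors `U` are the identity. -/
theorem hasFDerivAt_tucker_shrink_core {M : E → Factors p}
    {M' : ∀ k, Fin (p k) → Fin (p k) → E →L[ℝ] ℝ} {C : E → Tensor p}
    {C' : Idx p → E →L[ℝ] ℝ} {x : E} {g : Idx p → ℝ → ℝ}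
    (hM : ∀ k a b, HasFDerivAt (fun y => M y k a b) (M' k a b) x) (hMx : ∀ k, M x k = 1)
    (hC : ∀ i, HasFDerivAt (fun y => C y i) (C' i) x)
    (hg : ∀ i, DifferentiableAt ℝ (g i) (C x i)) (i : Idx p) :
    HasFDerivAt (fun y => tucker (M y) (shrink g (core (M y) (C y))) i)
      (deriv (g i) (C x i) •
          (C' i + ∑ k, ∑ a, C x (Function.update i k a) • M' k a (i k)) +
        ∑ k, ∑ a, g (Function.update i k a) (C x (Function.update i k a)) • M' k (i k) a) x := by
  have hMTx : ∀ k, (M x k).transpose = 1 := fun k => by rw [hMx, Matrix.transpose_one]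
  have hcore : core (M x) (C x) = C x := by simp only [core, hMTx, tucker_one]
  have hP : ∀ i, HasFDerivAt (fun y => core (M y) (C y) i)
      (C' i + ∑ k, ∑ a, C x (Function.update i k a) • M' k a (i k)) x := fun i =>
    hasFDerivAt_tucker_apply (M := fun y k => (M y k).transpose) (M' := fun k a b => M' k b a)
      (fun k a b => hM k b a) hMTx hC i
  have hG : ∀ i, HasFDerivAt (fun y => shrink g (core (M y) (C y)) i)
      (deriv (g i) (C x i) •
        (C' i + ∑ k, ∑ a, C x (Function.update i k a) • M' k a (i k))) x := fun i => by
    have h1 : HasDerivAt (g i) (deriv (g i) (C x i)) (core (M x) (C x) i) := by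
      rw [hcore]; exact (hg i).hasDerivAt
    exact h1.comp_hasFDerivAt x (hP i)
  have h := hasFDerivAt_tucker_apply hM hMx hG i
  simp only [shrink_apply, hcore] at h
  exact h

/-- The derivative at `X` of the relative factors `U₀ᵀ * U`. -/
theorem hasFDerivAt_transpose_mul_factors {X : Tensor p} {U₀ : Factors p}
    {σ : ∀ k : Fin K, Fin (p k) → ℝ} (hX : IsHOSVD X U₀ σ) (hσ : ∀ k, Function.Injective (σ k))
    {U : Tensor p → Factors p} (hU : ∀ᶠ Y in 𝓝 X, ∃ σY, IsHOSVD Y (U Y) σY) (hUX : U X = U₀)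
    (hUc : ContinuousAt U X) {C' : Idx p → Tensor p →L[ℝ] ℝ}
    (hC : ∀ i, HasFDerivAt (fun Y => core U₀ Y i) (C' i) X) (k : Fin K) (a b : Fin (p k)) :
    HasFDerivAt (fun Y => ((U₀ k).transpose * U Y k) a b)
      (if a = b then 0 else (σ k b ^ 2 - σ k a ^ 2)⁻¹ • gramDeriv k (core U₀ X) C' a b) X := by
  rw [isHOSVD_iff] at hX
  have hU₀ := fun k => (hX k).orthogonal
  obtain ⟨s, hs⟩ := hU.choice
  have hrot : ∀ᶠ Y in 𝓝 X,
      IsSqEig (gram k (core U₀ Y)) ((U₀ k).transpose * U Y k) (s Y k) := by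
    filter_upwards [hs] with Y hY
    rw [gram_core hU₀]
    exact (isHOSVD_iff.1 hY k).transpose_mul (hU₀ k)
  exact hasFDerivAt_eigenvectors (B := fun Y => gram k (core U₀ Y))
    (V := fun Y => (U₀ k).transpose * U Y k) (c := fun Y j => s Y k j ^ 2)
    (strictAnti_sq (hX k).nonneg (hX k).antitone (hσ k)).injective
    (hasFDerivAt_gram hC k) (by rw [gram_core hU₀, (hX k).transpose_mul_mul])
    (by rw [hUX, transpose_mul_of_mem_orthogonalGroup (hU₀ k)])
    (tendsto_const_nhds.mul (tendsto_pi_nhds.1 hUc k))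
    (hrot.mono fun Y h => h.orthogonal) (hrot.mono fun Y h => h.eq) a b

/-- The closed form of the divergence before its first part is summed in a symmetric way. -/
theorem divergenceFormula_eq_sum (g : Idx p → ℝ → ℝ) (S : Tensor p)
    (σ : ∀ k : Fin K, Fin (p k) → ℝ) :
    divergenceFormula g S σ = ∑ i : Idx p,
      (deriv (g i) (S i) * (1 + ∑ k, ∑ a ∈ Finset.univ.erase (i k),
          S (Function.update i k a) ^ 2 / (σ k (i k) ^ 2 - σ k a ^ 2)) +
        ∑ k, ∑ a ∈ Finset.univ.erase (i k), S (Function.update i k a) *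
          g (Function.update i k a) (S (Function.update i k a)) *
            (1 / (σ k a ^ 2 - σ k (i k) ^ 2))) := by
  rw [divergenceFormula, Finset.sum_add_distrib, Finset.sum_add_distrib, add_comm]
  congr 1
  simp only [Finset.mul_sum]
  rw [Finset.sum_comm, Finset.sum_comm (s := (Finset.univ : Finset (Idx p)))]
  refine Finset.sum_congr rfl fun k _ => ?_
  have h := sum_update_comm k fun i j => S i * g i (S i) * (1 / (σ k (i k) ^ 2 - σ k j ^ 2))
  simp only [Function.update_self] at h
  exact h.symm

/-- Differentiability and divergence for factors that are continuous at `X`. The divergence is the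
trace of the derivative, computed in the coordinates rotated by `U₀`. -/
theorem differentiableAt_estimator_and_divergence {X : Tensor p} {U₀ : Factors p}
    {σ : ∀ k : Fin K, Fin (p k) → ℝ} (hX : IsHOSVD X U₀ σ) (hσ : ∀ k, Function.Injective (σ k))
    {U : Tensor p → Factors p} {g : Idx p → ℝ → ℝ}
    (hU : ∀ᶠ Y in 𝓝 X, ∃ σY, IsHOSVD Y (U Y) σY) (hUX : U X = U₀) (hUc : ContinuousAt U X)
    (hg : ∀ i, DifferentiableAt ℝ (g i) (core U₀ X i)) :
    DifferentiableAt ℝ (estimator U g) X ∧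
      divergence (estimator U g) X = divergenceFormula g (core U₀ X) σ := by
  have hU₀ := fun k => (isHOSVD_iff.1 hX k).orthogonal
  obtain ⟨C', hC, hC'e⟩ : ∃ C' : Idx p → Tensor p →L[ℝ] ℝ,
      (∀ i, HasFDerivAt (fun Y => core U₀ Y i) (C' i) X) ∧
      ∀ i j, C' j (tucker U₀ (EuclideanSpace.single i 1)) = if j = i then 1 else 0 := by
    refine ⟨_, fun i => hasFDerivAt_tucker_const _ X i, fun i j => ?_⟩
    change tucker (fun k => (U₀ k).transpose) (tucker U₀ (EuclideanSpace.single i 1)) j = _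
    rw [tucker_transpose_tucker hU₀, PiLp.single_apply]
  have hM := hasFDerivAt_transpose_mul_factors hX hσ hU hUX hUc hC
  have hMX : ∀ k, (U₀ k).transpose * U X k = 1 := fun k => by
    rw [hUX, transpose_mul_of_mem_orthogonalGroup (hU₀ k)]
  have hf := hasFDerivAt_tucker_shrink_core (M := fun Y k => (U₀ k).transpose * U Y k)
    (C := core U₀) hM hMX hC hg
  rw [funext (estimator_eq_tucker hU₀ U g), divergenceFormula_eq_sum]
  obtain ⟨hd, hdiv⟩ := differentiableAt_tucker_comp_and_divergence hf U₀
  refine ⟨hd, hdiv.trans (Finset.sum_congr rfl fun i _ => ?_)⟩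
  simp only [add_apply, smul_apply, sum_apply, smul_eq_mul, hC'e, if_true]
  -- Diagonal entries of the factors do not contribute, as their derivatives vanish.
  have herase : ∀ F : ∀ k, Fin (p k) → ℝ, (∀ k, F k (i k) = 0) →
      ∑ k, ∑ a, F k a = ∑ k, ∑ a ∈ Finset.univ.erase (i k), F k a := fun F hF =>
    Finset.sum_congr rfl fun k _ => (Finset.sum_erase _ (hF k)).symm
  rw [herase _ fun k => by simp, herase _ fun k => by simp]
  congr 1
  · congr 2
    refine Finset.sum_congr rfl fun k _ => Finset.sum_congr rfl fun a ha => ?_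
    have hne := Finset.ne_of_mem_erase ha
    rw [if_neg hne, smul_apply, smul_eq_mul, gramDeriv_comm,
      gramDeriv_apply_of_ne k _ (hC'e i) hne]
    ring
  · refine Finset.sum_congr rfl fun k _ => Finset.sum_congr rfl fun a ha => ?_
    have hne := Finset.ne_of_mem_erase ha
    rw [if_neg hne.symm, smul_apply, smul_eq_mul, gramDeriv_apply_of_ne k _ (hC'e i) hne]
    ring

end HOSVD
end

theorem mainTheorem2 {K : ℕ} (p : Fin K → ℕ) (X : HOSVD.Tensor p)
    (U₀ : HOSVD.Factors p) (σ : ∀ k : Fin K, Fin (p k) → ℝ)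
    (hX : HOSVD.IsHOSVD X U₀ σ)
    (hσ : ∀ k, Function.Injective (σ k)) :
    (∃ U : HOSVD.Tensor p → HOSVD.Factors p,
      (∀ Y, ∃ σY, HOSVD.IsHOSVD Y (U Y) σY) ∧ U X = U₀ ∧ ContinuousAt U X) ∧
    ∀ (U : HOSVD.Tensor p → HOSVD.Factors p) (g : HOSVD.Idx p → ℝ → ℝ),
      (∀ᶠ Y in 𝓝 X, ∃ σY, HOSVD.IsHOSVD Y (U Y) σY) → U X = U₀ →
      (ContinuousAt U X ∨ ∀ i s, g i (-s) = -g i s) →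
      (∀ i, DifferentiableAt ℝ (g i) (HOSVD.core U₀ X i)) →
      X = HOSVD.tucker U₀ (HOSVD.core U₀ X) ∧
      DifferentiableAt ℝ (HOSVD.estimator U g) X ∧
      HOSVD.divergence (HOSVD.estimator U g) X =
        HOSVD.divergenceFormula g (HOSVD.core U₀ X) σ ∧
      ∀ τ : ℝ, HOSVD.sure τ (HOSVD.estimator U g) X =
        -((∏ k, p k : ℕ) : ℝ) * τ ^ 2
          + ‖HOSVD.shrink g (HOSVD.core U₀ X) - HOSVD.core U₀ X‖ ^ 2
          + 2 * τ ^ 2 * HOSVD.divergenceFormula g (HOSVD.core U₀ X) σ := by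
  have hU₀ := fun k => (HOSVD.isHOSVD_iff.1 hX k).orthogonal
  refine ⟨?_, fun U g hU hUX hcg hg => ?_⟩
  · choose V σV hV using HOSVD.exists_isHOSVD (p := p)
    classical
    have hW : ∀ Y, ∃ σY, HOSVD.IsHOSVD Y (Function.update V X U₀ Y) σY := by
      intro Y
      by_cases hY : Y = X
      · subst hY; exact ⟨σ, by simpa using hX⟩
      · exact ⟨σV Y, by simpa [hY] using hV Y⟩
    refine ⟨fun Y => HOSVD.alignSigns U₀ (Function.update V X U₀ Y), fun Y => ?_, ?_, ?_⟩
    · exact (hW Y).imp fun _ h => h.alignSigns U₀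
    · simp only [Function.update_self, HOSVD.alignSigns_self hU₀]
    · exact HOSVD.continuousAt_alignSigns hX hσ (Eventually.of_forall hW)
        (Function.update_self X U₀ V)
  · have hXS : X = HOSVD.tucker U₀ (HOSVD.core U₀ X) :=
      (HOSVD.tucker_tucker_transpose hU₀ X).symm
    have hmain : DifferentiableAt ℝ (HOSVD.estimator U g) X ∧
        HOSVD.divergence (HOSVD.estimator U g) X =
          HOSVD.divergenceFormula g (HOSVD.core U₀ X) σ := by
      rcases hcg with hc | hodd
      · exact HOSVD.differentiableAt_estimator_and_divergence hX hσ hU hUX hc hg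
      · rw [← HOSVD.estimator_alignSigns hodd U₀ U]
        exact HOSVD.differentiableAt_estimator_and_divergence hX hσ
          (hU.mono fun Y h => h.imp fun _ h => h.alignSigns U₀)
          (by rw [hUX, HOSVD.alignSigns_self hU₀])
          (HOSVD.continuousAt_alignSigns hX hσ hU hUX) hg
    refine ⟨hXS, hmain.1, hmain.2, fun τ => ?_⟩
    have hnorm : ‖HOSVD.estimator U g X - X‖ =
        ‖HOSVD.shrink g (HOSVD.core U₀ X) - HOSVD.core U₀ X‖ := by
      rw [← HOSVD.norm_tucker hU₀ (HOSVD.shrink g (HOSVD.core U₀ X) - HOSVD.core U₀ X),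
        ← HOSVD.tuckerLM_apply, map_sub, HOSVD.tuckerLM_apply, HOSVD.tuckerLM_apply, ← hXS,
        HOSVD.estimator, hUX]
    rw [HOSVD.sure, hmain.2, hnorm]
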